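/- **Theorem (characterizations of approximate convexity).** Throughout, $\mathbb{R}^m$ and $\mathbb{R}^n\times\mathbb{R}$ carry the Euclidean inner product and norm, and $\mathbb{B}_\delta(z)$ is the closed ball of radius $\delta$ around $z$. For $\Omega\subseteq\mathbb{R}^m$ and $\omega\in\Omega$, the *Fréchet normal cone* $\hat N_\Omega(\omega)$ is the set of all $v$ such that for every $\varepsilon>0$ there is $\delta>0$ with $\langle v,u-\omega\rangle\le\varepsilon\|u-\omega\|$ for all $u\in\Omega\cap\mathbb{B}_\delta(\omega)$; the *limiting normal cone* $N_\Omega(\omega)$ is the set of all limits of sequences $v_k\in\hat N_\Omega(\omega_k)$ with $\omega_k\in\Omega$, $\omega_k\to\omega$; and the *Clarke normal cone* is $N^{\mathrm C}_\Omega(\omega)=\operatorname{cl}\operatorname{conv}N_\Omega(\omega)$. All three are empty at points outside $\Omega$. The set $\Omega$ is *Clarke super-regular* at $\bar\omega\in\Omega$ if $\Omega\cap\mathbb{B}_r(\bar\omega)$ is closed for some $r>0$ and for every $\varepsilon>0$ there is $\delta>0$ such that $$\langle v,\omega-\hat\omega\rangle\le\varepsilon\|v\|\,\|\omega-\hat\omega\|\qquad\text{for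 all }\hat\omega\in\mathbb{B}_\delta(\bar\omega),\ v\in N^{\mathrm C}_\Omega(\hat\omega),\ \omega\in\Omega\cap\mathbb{B}_\delta(\bar\omega).$$ For $f:\mathbb{R}^n\to\mathbb{R}$ let $\operatorname{epi}f=\{(x,\alpha)\in\mathbb{R}^n\times\mathbb{R}: f(x)\le\alpha\}$. The *limiting* and *Clarke subdifferentials* of $f$ at $x$ are $$\partial f(x)=\{v:(v,-1)\in N_{\operatorname{epi}f}(x,f(x))\},\qquad \partial^{\mathrm C}f(x)=\{v:(v,-1)\in N^{\mathrm C}_{\operatorname{epi}f}(x,f(x))\}.$$ Let $f:\mathbb{R}^n\to\mathbb{R}$ be locally Lipschitz on $\mathbb{R}^n$ and let $\bar x\in\mathbb{R}^n$. Then the following are equivalent. 1. $\operatorname{epi}f$ is Clarke super-regular at $(\bar x,f(\bar x))$. 2. $f$ is approximately convex at $\bar x$: for every $\varepsilon>0$ there is $\delta>0$ such that for all $x,y\in\mathbb{B}_\delta(\bar x)$ and all $t\in(0,1)$, $$f(tx+(1-t)y)\le tf(x)+(1-t)f(y)+\varepsilon t(1-t)\|x-y\|.$$ 3. For every $\varepsilon>0$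 there is $\delta>0$ such that for all $x,y\in\mathbb{B}_\delta(\bar x)$ and all $v\in\partial^{\mathrm C}f(x)$, $$f(y)-f(x)\ge\langle v,y-x\rangle-\varepsilon\|y-x\|.$$ 4. $\partial f$ is submonotone at $\bar x$: for every $\varepsilon>0$ there is $\delta>0$ such that for all $x_1,x_2\in\mathbb{B}_\delta(\bar x)$ and all $x_i^*\in\partial f(x_i)$ ($i=1,2$), $$\langle x_1^*-x_2^*,x_1-x_2\rangle\ge-\varepsilon\|x_1-x_2\|.$$ -/

import Mathlib

open Set Filter Topology Metric

namespace ClarkeReg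

section Sets

variable {E : Type*} [NormedAddCommGroup E] [InnerProductSpace ℝ E]

/-- The Fréchet normal cone of `Ω` at `w` (empty when `w ∉ Ω`). -/
def frechetNormalCone (Ω : Set E) (w : E) : Set E :=
  {v | w ∈ Ω ∧ ∀ ε > (0 : ℝ), ∃ δ > (0 : ℝ), ∀ u ∈ Ω ∩ closedBall w δ,
    inner ℝ v (u - w) ≤ ε * ‖u - w‖}

/-- The Painlevé–Kuratowski outer limit of a set-valued map `S` at `w`: all limits of sequences
`v k ∈ S (x k)` along sequences `x k → w`. -/
def outerLimit (S : E → Set E) (w : E) : Set E :=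
  {v | ∃ (x : ℕ → E) (u : ℕ → E), Tendsto x atTop (𝓝 w) ∧ Tendsto u atTop (𝓝 v) ∧
    ∀ k, u k ∈ S (x k)}

/-- The limiting normal cone of `Ω` at `w` (empty when `w ∉ Ω`). -/
def limitingNormalCone (Ω : Set E) (w : E) : Set E :=
  {v | w ∈ Ω ∧ v ∈ outerLimit (frechetNormalCone Ω) w}

/-- The Clarke normal cone of `Ω` at `w`: the closed convex hull of the limiting normal cone
(empty when `w ∉ Ω`). -/
def clarkeNormalCone (Ω : Set E) (w : E) : Set E :=
  closure (convexHull ℝ (limitingNormalCone Ω w))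

/-- `Ω` is locally closed at `w`: its intersection with some closed ball around `w` is closed. -/
def LocallyClosedAt (Ω : Set E) (w : E) : Prop :=
  ∃ r > (0 : ℝ), IsClosed (Ω ∩ closedBall w r)

/-- Clarke super-regularity of `Ω` at the point `w₀ ∈ Ω`. -/
def ClarkeSuperRegularAt (Ω : Set E) (w₀ : E) : Prop :=
  w₀ ∈ Ω ∧ LocallyClosedAt Ω w₀ ∧
    ∀ ε > (0 : ℝ), ∃ δ > (0 : ℝ), ∀ z ∈ closedBall w₀ δ, ∀ v ∈ clarkeNormalCone Ω z,
      ∀ w ∈ Ω ∩ closedBall w₀ δ, inner ℝ v (w - z) ≤ ε * ‖v‖ * ‖w - z‖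

/-- Submonotonicity at `x₀` of a set-valued map `T`. Points outside the domain of `T`, where the
value is empty, impose no condition. -/
def SubmonotoneAt (T : E → Set E) (x₀ : E) : Prop :=
  ∀ ε > (0 : ℝ), ∃ δ > (0 : ℝ), ∀ x₁ ∈ closedBall x₀ δ, ∀ x₂ ∈ closedBall x₀ δ,
    ∀ v₁ ∈ T x₁, ∀ v₂ ∈ T x₂, inner ℝ (v₁ - v₂) (x₁ - x₂) ≥ -ε * ‖x₁ - x₂‖

end Sets

section Functions

variable {E : Type*} [NormedAddCommGroup E] [InnerProductSpace ℝ E]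

/-- The epigraph of `f`, in `E × ℝ` with the Euclidean (`ℓ²`) product norm. -/
def epi (f : E → ℝ) : Set (WithLp 2 (E × ℝ)) :=
  {p | f p.fst ≤ p.snd}

/-- The limiting subdifferential of `f` at `x`. -/
def limitingSubdifferential (f : E → ℝ) (x : E) : Set E :=
  {v | WithLp.toLp 2 (v, (-1 : ℝ)) ∈ limitingNormalCone (epi f) (WithLp.toLp 2 (x, f x))}

/-- The Clarke subdifferential of `f` at `x`. -/
def clarkeSubdifferential (f : E → ℝ) (x : E) : Set E :=
  {v | WithLp.toLp 2 (v, (-1 : ℝ)) ∈ clarkeNormalCone (epi f) (WithLp.toLp 2 (x, f x))}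

/-- Approximate convexity of `f` at `x₀`. -/
def ApproximatelyConvexAt (f : E → ℝ) (x₀ : E) : Prop :=
  ∀ ε > (0 : ℝ), ∃ δ > (0 : ℝ), ∀ x ∈ closedBall x₀ δ, ∀ y ∈ closedBall x₀ δ,
    ∀ t ∈ Ioo (0 : ℝ) 1,
      f (t • x + (1 - t) • y) ≤ t * f x + (1 - t) * f y + ε * t * (1 - t) * ‖x - y‖

end Functions

end ClarkeReg

/-!
Everything is reduced to one property, `FrechetFirstOrderAt`: the first-order inequality
`f y - f x ≥ ⟪v, y - x⟫ - ε ‖y - x‖` near `x₀`, required of *Fréchet* subgradients `v` only.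

* A Fréchet normal to `epi f` is either zero or a positive multiple of some `(v, -1)` with `v` a
  Fréchet subgradient, since horizontal normals are excluded by the Lipschitz property. For such a
  normal `v` at `z` the first-order inequality reads `⟪v, w - z⟫ ≤ ε * -v.snd * ‖w.fst - z.fst‖`.
  This inequality is linear in `v` and stable under limits, hence it survives the passage to
  limiting normals and to closed convex hulls (`FrechetFirstOrderAt.clarkeNormalCone_epi`). It gives
  both Clarke super-regularity of the epigraph and the first-order inequality for Clarke
  subgradients. Conversely, super-regularity applied to the normals `(v, -1)` and to points of the
  graph gives back the first-order inequality, because `‖(v, -1)‖` and the slopes of `f` are bounded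
  by the Lipschitz constant.
* Approximate convexity gives the first-order inequality by dividing by `t` as `t → 0`. In the other
  direction one adds the two inequalities at a subgradient taken near the convex combination.
* The first-order inequality, written twice with `x` and `y` exchanged, sums to submonotonicity. The
  way back needs a mean value inequality (`exists_frechetSubdifferential_inner_le`), obtained by
  minimizing `f u - t r + k ‖u - (a + t (b - a))‖²` over `t ∈ [0, 1]` and `u` in a ball:
  stationarity in `u` produces a Fréchet subgradient, stationarity in `t` bounds its slope along
  `b - a`. This is the only place where compactness of closed balls is used. With `a = b` it also
  provides the subgradients near a given point that approximate convexity requires.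
-/

namespace ClarkeReg

/-! ### The Euclidean product `F × ℝ` and local Lipschitz bounds -/

theorem norm_fst_le {F : Type*} [NormedAddCommGroup F] (p : WithLp 2 (F × ℝ)) : ‖p.fst‖ ≤ ‖p‖ := by
  rw [WithLp.prod_norm_eq_of_L2]
  exact Real.le_sqrt_of_sq_le (by nlinarith [sq_nonneg ‖p.snd‖])

theorem abs_snd_le {F : Type*} [NormedAddCommGroup F] (p : WithLp 2 (F × ℝ)) : |p.snd| ≤ ‖p‖ := by
  rw [← Real.norm_eq_abs, WithLp.prod_norm_eq_of_L2]
  exact Real.le_sqrt_of_sq_le (by nlinarith [sq_nonneg ‖p.fst‖])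

theorem norm_le_fst_add_snd {F : Type*} [NormedAddCommGroup F] (p : WithLp 2 (F × ℝ)) :
    ‖p‖ ≤ ‖p.fst‖ + |p.snd| := by
  rw [← Real.norm_eq_abs, WithLp.prod_norm_eq_of_L2]
  exact Real.sqrt_le_iff.2 ⟨by positivity,
    by nlinarith [mul_nonneg (norm_nonneg p.fst) (norm_nonneg p.snd)]⟩

/-- The local Lipschitz estimate on a closed ball, in the form used throughout. -/
theorem _root_.LocallyLipschitz.exists_closedBall {F : Type*} [NormedAddCommGroup F]
    {f : F → ℝ} (hf : LocallyLipschitz f) (x : F) :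
    ∃ L ≥ (0 : ℝ), ∃ R > (0 : ℝ), ∀ y ∈ closedBall x R, ∀ z ∈ closedBall x R,
      |f y - f z| ≤ L * ‖y - z‖ := by
  obtain ⟨K, t, ht, hK⟩ := hf x
  obtain ⟨R, hR, hRt⟩ := Metric.nhds_basis_closedBall.mem_iff.1 ht
  refine ⟨K, K.2, R, hR, fun y hy z hz ↦ ?_⟩
  simpa [Real.dist_eq, dist_eq_norm] using hK.dist_le_mul y (hRt hy) z (hRt hz)

variable {E : Type*} [NormedAddCommGroup E] [InnerProductSpace ℝ E]

/-! ### Fréchet subgradients and Fréchet normals to the epigraph -/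

/-- The Fréchet subdifferential of `f` at `x`, in its analytic form. -/
def frechetSubdifferential (f : E → ℝ) (x : E) : Set E :=
  {v | ∀ ε > (0 : ℝ), ∃ δ > (0 : ℝ), ∀ y ∈ closedBall x δ,
    inner ℝ v (y - x) - ε * ‖y - x‖ ≤ f y - f x}

/-- The first-order inequality characterizing approximate convexity, required of Fréchet
subgradients only. -/
def FrechetFirstOrderAt (f : E → ℝ) (x₀ : E) : Prop :=
  ∀ ε > (0 : ℝ), ∃ δ > (0 : ℝ), ∀ x ∈ closedBall x₀ δ, ∀ y ∈ closedBall x₀ δ,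
    ∀ v ∈ frechetSubdifferential f x, inner ℝ v (y - x) - ε * ‖y - x‖ ≤ f y - f x

theorem inner_eq_fst_add_snd (p q : WithLp 2 (E × ℝ)) :
    inner ℝ p q = inner ℝ p.fst q.fst + p.snd * q.snd := by
  rw [WithLp.prod_inner_apply]
  simp [mul_comm]

theorem toLp_mem_frechetNormalCone_epi {f : E → ℝ} {x v : E}
    (hv : v ∈ frechetSubdifferential f x) :
    WithLp.toLp 2 (v, (-1 : ℝ)) ∈ frechetNormalCone (epi f) (WithLp.toLp 2 (x, f x)) := by
  refine ⟨le_refl (f x), fun ε hε ↦ ?_⟩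
  obtain ⟨δ, hδ, h⟩ := hv ε hε
  refine ⟨δ, hδ, fun u ⟨hu, hub⟩ ↦ ?_⟩
  rw [mem_closedBall, dist_eq_norm] at hub
  have hn := norm_fst_le (u - WithLp.toLp 2 (x, f x))
  have h1 := h u.fst (by rw [mem_closedBall, dist_eq_norm]; exact hn.trans hub)
  have hu' : f u.fst ≤ u.snd := hu
  rw [inner_eq_fst_add_snd]
  simp only [WithLp.sub_fst, WithLp.sub_snd, WithLp.toLp_fst, WithLp.toLp_snd] at hn ⊢
  have := mul_le_mul_of_nonneg_left hn hε.le
  linarith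

/-- The vertical component of a Fréchet normal to an epigraph is nonpositive. -/
theorem snd_nonpos_of_mem_frechetNormalCone_epi {f : E → ℝ} {z v : WithLp 2 (E × ℝ)}
    (hv : v ∈ frechetNormalCone (epi f) z) : v.snd ≤ 0 := by
  obtain ⟨hz, hv⟩ := hv
  refine le_of_forall_pos_le_add fun ε hε ↦ ?_
  obtain ⟨δ, hδ, h⟩ := hv ε hε
  have hz' : f z.fst ≤ z.snd := hz
  have hw : ‖(WithLp.toLp 2 ((0 : E), δ))‖ ≤ δ :=
    (norm_le_fst_add_snd _).trans (by simp [abs_of_pos hδ])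
  have h1 := h (z + WithLp.toLp 2 (0, δ))
    ⟨by simp only [epi, mem_ofPred_eq, WithLp.add_fst, WithLp.add_snd, WithLp.toLp_fst, WithLp.toLp_snd,
      add_zero]; linarith,
     by simpa [dist_eq_norm] using hw⟩
  rw [inner_eq_fst_add_snd, add_sub_cancel_left] at h1
  simp only [WithLp.toLp_fst, WithLp.toLp_snd, inner_zero_right] at h1
  nlinarith

/-- A Fréchet normal with nonzero vertical component is attached to a point of the graph. -/
theorem snd_eq_of_mem_frechetNormalCone_epi {f : E → ℝ} {z v : WithLp 2 (E × ℝ)}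
    (hv : v ∈ frechetNormalCone (epi f) z) (hv0 : v.snd < 0) : z.snd = f z.fst := by
  obtain ⟨hz, hv⟩ := hv
  have hz' : f z.fst ≤ z.snd := hz
  by_contra hne
  have hlt : 0 < z.snd - f z.fst := sub_pos.2 (lt_of_le_of_ne hz' (Ne.symm hne))
  obtain ⟨δ, hδ, h⟩ := hv (-v.snd / 2) (by linarith)
  set s := min δ (z.snd - f z.fst)
  have hs0 : 0 < s := lt_min hδ hlt
  have hsδ : s ≤ δ := min_le_left _ _
  have hsz : s ≤ z.snd - f z.fst := min_le_right _ _
  have hw : ‖(WithLp.toLp 2 ((0 : E), -s))‖ ≤ s :=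
    (norm_le_fst_add_snd _).trans (by simp [abs_of_pos hs0])
  have h1 := h (z + WithLp.toLp 2 (0, -s))
    ⟨by simp only [epi, mem_ofPred_eq, WithLp.add_fst, WithLp.add_snd, WithLp.toLp_fst, WithLp.toLp_snd,
      add_zero]; linarith,
     by simpa [dist_eq_norm] using hw.trans hsδ⟩
  rw [inner_eq_fst_add_snd, add_sub_cancel_left] at h1
  simp only [WithLp.toLp_fst, WithLp.toLp_snd, inner_zero_right] at h1
  nlinarith

/-- Fréchet normals to the epigraph of an `L`-Lipschitz function lie in the cone of slope `L`;
in particular there are no nonzero horizontal ones. -/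
theorem norm_fst_le_of_mem_frechetNormalCone_epi {f : E → ℝ} {z v : WithLp 2 (E × ℝ)} {L R : ℝ}
    (hL0 : 0 ≤ L) (hR : 0 < R) (hL : ∀ y ∈ closedBall z.fst R, f y - f z.fst ≤ L * ‖y - z.fst‖)
    (hv : v ∈ frechetNormalCone (epi f) z) : ‖v.fst‖ ≤ L * -v.snd := by
  rcases eq_or_ne v.fst 0 with h0 | h0
  · have := snd_nonpos_of_mem_frechetNormalCone_epi hv
    rw [h0, norm_zero]
    exact mul_nonneg hL0 (by linarith)
  obtain ⟨hz, hv⟩ := hv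
  have hz' : f z.fst ≤ z.snd := hz
  have hp : 0 < ‖v.fst‖ := norm_pos_iff.2 h0
  refine le_of_forall_pos_le_add fun ε hε ↦ ?_
  obtain ⟨δ, hδ, h⟩ := hv (ε / (1 + L)) (by positivity)
  -- Test the normal along the direction `(v.fst, L * ‖v.fst‖)`, which stays in the epigraph.
  set s := min R (δ / (1 + L)) / ‖v.fst‖
  have hs0 : 0 < s := div_pos (lt_min hR (by positivity)) hp
  have hsn : s * ‖v.fst‖ = min R (δ / (1 + L)) := div_mul_cancel₀ _ hp.ne'
  have hsR : s * ‖v.fst‖ ≤ R := hsn ▸ min_le_left _ _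
  have hsδ : s * ‖v.fst‖ * (1 + L) ≤ δ := by
    rw [← le_div_iff₀ (by positivity)]; exact hsn ▸ min_le_right _ _
  have hns : ‖s • v.fst‖ = s * ‖v.fst‖ := by rw [norm_smul, Real.norm_eq_abs, abs_of_pos hs0]
  have hw : ‖(WithLp.toLp 2 (s • v.fst, L * (s * ‖v.fst‖)))‖ ≤ s * ‖v.fst‖ * (1 + L) := by
    refine (norm_le_fst_add_snd _).trans ?_
    change ‖s • v.fst‖ + |L * (s * ‖v.fst‖)| ≤ _
    rw [hns, abs_of_nonneg (by positivity)]
    linarith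
  have hepi := hL (z.fst + s • v.fst) (by simpa [dist_eq_norm, hns] using hsR)
  rw [add_sub_cancel_left, hns] at hepi
  have h1 := h (z + WithLp.toLp 2 (s • v.fst, L * (s * ‖v.fst‖)))
    ⟨by simp only [epi, mem_ofPred_eq, WithLp.add_fst, WithLp.add_snd, WithLp.toLp_fst,
      WithLp.toLp_snd]; linarith,
     by simpa [dist_eq_norm] using hw.trans hsδ⟩
  rw [inner_eq_fst_add_snd, add_sub_cancel_left] at h1
  simp only [WithLp.toLp_fst, WithLp.toLp_snd, inner_smul_right, real_inner_self_eq_norm_sq] at h1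
  have h2 : ε / (1 + L) * ‖(WithLp.toLp 2 (s • v.fst, L * (s * ‖v.fst‖)))‖
      ≤ ε * (s * ‖v.fst‖) := by
    refine (mul_le_mul_of_nonneg_left hw (by positivity)).trans (le_of_eq ?_)
    field_simp
  have h3 : (s * ‖v.fst‖) * ‖v.fst‖ ≤ (s * ‖v.fst‖) * (L * -v.snd + ε) := by
    nlinarith
  exact le_of_mul_le_mul_left h3 (by positivity)

theorem norm_le_of_mem_frechetSubdifferential {f : E → ℝ} {x v : E} {L R : ℝ}
    (hL0 : 0 ≤ L) (hR : 0 < R) (hL : ∀ y ∈ closedBall x R, f y - f x ≤ L * ‖y - x‖)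
    (hv : v ∈ frechetSubdifferential f x) : ‖v‖ ≤ L := by
  simpa using norm_fst_le_of_mem_frechetNormalCone_epi (z := WithLp.toLp 2 (x, f x)) hL0 hR hL
    (toLp_mem_frechetNormalCone_epi hv)

/-- Rescaling a Fréchet normal to vertical component `-1` gives a Fréchet subgradient. -/
theorem smul_fst_mem_frechetSubdifferential {f : E → ℝ} {z v : WithLp 2 (E × ℝ)} {L R : ℝ}
    (hL0 : 0 ≤ L) (hR : 0 < R)
    (hL : ∀ y ∈ closedBall z.fst R, |f y - f z.fst| ≤ L * ‖y - z.fst‖)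
    (hv : v ∈ frechetNormalCone (epi f) z) (hv0 : v.snd < 0) :
    (-v.snd)⁻¹ • v.fst ∈ frechetSubdifferential f z.fst := by
  have hzf := snd_eq_of_mem_frechetNormalCone_epi hv hv0
  have hl : 0 < -v.snd := by linarith
  intro ε hε
  obtain ⟨δ, hδ, h⟩ := hv.2 (ε * -v.snd / (1 + L)) (by positivity)
  refine ⟨min R (δ / (1 + L)), lt_min hR (by positivity), fun y hy ↦ ?_⟩
  have hyR := hL y (closedBall_subset_closedBall (min_le_left _ _) hy)
  have hyδ : ‖y - z.fst‖ * (1 + L) ≤ δ := by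
    rw [← le_div_iff₀ (by positivity), ← dist_eq_norm]
    exact closedBall_subset_closedBall (min_le_right _ _) hy
  have hw : ‖WithLp.toLp 2 (y, f y) - z‖ ≤ ‖y - z.fst‖ * (1 + L) := by
    refine (norm_le_fst_add_snd _).trans ?_
    simp only [WithLp.sub_fst, WithLp.sub_snd, WithLp.toLp_fst, WithLp.toLp_snd, hzf]
    linarith
  have h1 := h (WithLp.toLp 2 (y, f y))
    ⟨le_refl (f y), by rw [mem_closedBall, dist_eq_norm]; exact hw.trans hyδ⟩
  rw [inner_eq_fst_add_snd] at h1
  simp only [WithLp.sub_fst, WithLp.sub_snd, WithLp.toLp_fst, WithLp.toLp_snd, hzf] at h1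
  have h2 : ε * -v.snd / (1 + L) * ‖WithLp.toLp 2 (y, f y) - z‖
      ≤ ε * -v.snd * ‖y - z.fst‖ := by
    refine (mul_le_mul_of_nonneg_left hw (by positivity)).trans (le_of_eq ?_)
    field_simp
  rw [real_inner_smul_left]
  refine le_of_mul_le_mul_left ?_ hl
  rw [mul_sub, mul_inv_cancel_left₀ hl.ne']
  nlinarith

/-! ### From Fréchet subgradients to Clarke normals -/

theorem frechetNormalCone_subset_limitingNormalCone (Ω : Set E) (w : E) :
    frechetNormalCone Ω w ⊆ limitingNormalCone Ω w := fun v hv ↦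
  ⟨hv.1, fun _ ↦ w, fun _ ↦ v, tendsto_const_nhds, tendsto_const_nhds, fun _ ↦ hv⟩

theorem limitingNormalCone_subset_clarkeNormalCone (Ω : Set E) (w : E) :
    limitingNormalCone Ω w ⊆ clarkeNormalCone Ω w :=
  (subset_convexHull ℝ _).trans subset_closure

/-- Under the first-order inequality for Fréchet subgradients, all Clarke normals to the epigraph
satisfy an inequality that is linear in the normal. Its linearity is what lets it pass from Fréchet
normals to limits and then to closed convex hulls. -/
theorem FrechetFirstOrderAt.clarkeNormalCone_epi {f : E → ℝ} {x₀ : E} (hf : LocallyLipschitz f)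
    (h : FrechetFirstOrderAt f x₀) {ε : ℝ} (hε : 0 < ε) :
    ∃ δ > (0 : ℝ), ∀ z : WithLp 2 (E × ℝ), z.fst ∈ closedBall x₀ δ →
      ∀ v ∈ clarkeNormalCone (epi f) z, ∀ w ∈ epi f, w.fst ∈ closedBall x₀ δ →
        inner ℝ v (w - z) ≤ ε * -v.snd * ‖w.fst - z.fst‖ := by
  obtain ⟨δ, hδ, hfo⟩ := h ε hε
  have key : ∀ z : WithLp 2 (E × ℝ), z.fst ∈ closedBall x₀ δ →
      ∀ v ∈ frechetNormalCone (epi f) z, ∀ w ∈ epi f, w.fst ∈ closedBall x₀ δ →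
        inner ℝ v (w - z) ≤ ε * -v.snd * ‖w.fst - z.fst‖ := by
    intro z hz v hv w hw hwb
    obtain ⟨L, hL0, R, hR, hL⟩ := hf.exists_closedBall z.fst
    have hL' := fun y hy ↦ hL y hy z.fst (mem_closedBall_self hR.le)
    rcases (snd_nonpos_of_mem_frechetNormalCone_epi hv).lt_or_eq with hv0 | hv0
    · have h1 := hfo _ hz _ hwb _ (smul_fst_mem_frechetSubdifferential hL0 hR hL' hv hv0)
      have hl : 0 < -v.snd := by linarith
      rw [real_inner_smul_left] at h1
      have h2 := mul_le_mul_of_nonneg_left h1 hl.le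
      rw [mul_sub, mul_inv_cancel_left₀ hl.ne'] at h2
      have hw' : f w.fst ≤ w.snd := hw
      rw [inner_eq_fst_add_snd]
      simp only [WithLp.sub_fst, WithLp.sub_snd,
        snd_eq_of_mem_frechetNormalCone_epi hv hv0]
      nlinarith
    · have h1 := norm_fst_le_of_mem_frechetNormalCone_epi hL0 hR
        (fun y hy ↦ (le_abs_self _).trans (hL' y hy)) hv
      have h2 : v.fst = 0 := norm_le_zero_iff.1 (by simpa [hv0] using h1)
      rw [inner_eq_fst_add_snd, h2, hv0]
      simp
  refine ⟨δ / 2, by positivity, fun z hz v hv w hw hwb ↦ ?_⟩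
  have hwb' : w.fst ∈ closedBall x₀ δ := closedBall_subset_closedBall (by linarith) hwb
  have hfst : Continuous fun p : WithLp 2 (E × ℝ) ↦ p.fst := WithLp.continuous_fst 2 E ℝ
  have hsnd : Continuous fun p : WithLp 2 (E × ℝ) ↦ p.snd := WithLp.continuous_snd 2 E ℝ
  let S : Set (WithLp 2 (E × ℝ)) := {v | inner ℝ v (w - z) ≤ ε * -v.snd * ‖w.fst - z.fst‖}
  have hSc : IsClosed S := isClosed_le (by fun_prop) (by fun_prop)
  have hSconv : Convex ℝ S := by
    intro a ha b hb s t hs ht _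
    have ha' : inner ℝ a (w - z) ≤ ε * -a.snd * ‖w.fst - z.fst‖ := ha
    have hb' : inner ℝ b (w - z) ≤ ε * -b.snd * ‖w.fst - z.fst‖ := hb
    change inner ℝ (s • a + t • b) (w - z) ≤ ε * -(s • a + t • b).snd * ‖w.fst - z.fst‖
    simp only [inner_add_left, real_inner_smul_left, WithLp.add_snd, WithLp.smul_snd, smul_eq_mul]
    linarith [mul_le_mul_of_nonneg_left ha' hs, mul_le_mul_of_nonneg_left hb' ht]
  have hlim : limitingNormalCone (epi f) z ⊆ S := by
    rintro v ⟨-, y, u, hy, hu, huy⟩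
    have hmem : ∀ᶠ k in atTop, (y k).fst ∈ closedBall x₀ δ := by
      have : Tendsto (fun k ↦ (y k).fst) atTop (𝓝 z.fst) := (hfst.tendsto z).comp hy
      refine this.eventually (closedBall_mem_nhds_of_mem ?_)
      exact (mem_closedBall.1 hz).trans_lt (by linarith)
    refine le_of_tendsto_of_tendsto (hu.inner (tendsto_const_nhds.sub hy))
      ((((hsnd.tendsto v).comp hu).neg.const_mul ε).mul
        (tendsto_const_nhds.sub ((hfst.tendsto z).comp hy)).norm) ?_
    filter_upwards [hmem] with k hk
    exact key _ hk _ (huy k) _ hw hwb'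
  exact hSc.closure_subset_iff.2 (convexHull_min hlim hSconv) hv

theorem FrechetFirstOrderAt.clarkeSuperRegularAt {f : E → ℝ} {x₀ : E} (hf : LocallyLipschitz f)
    (h : FrechetFirstOrderAt f x₀) :
    ClarkeSuperRegularAt (epi f) (WithLp.toLp 2 (x₀, f x₀)) := by
  have hball : ∀ {δ : ℝ} {z : WithLp 2 (E × ℝ)},
      z ∈ closedBall (WithLp.toLp 2 (x₀, f x₀)) δ → z.fst ∈ closedBall x₀ δ := by
    intro δ z hz
    rw [mem_closedBall, dist_eq_norm] at hz ⊢
    exact (norm_fst_le (z - WithLp.toLp 2 (x₀, f x₀))).trans hz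
  have hclosed : IsClosed (epi f) :=
    isClosed_le (hf.continuous.comp (WithLp.continuous_fst 2 E ℝ))
      (WithLp.continuous_snd 2 E ℝ)
  refine ⟨le_refl (f x₀), ⟨1, one_pos, hclosed.inter isClosed_closedBall⟩, fun ε hε ↦ ?_⟩
  obtain ⟨δ, hδ, hc⟩ := h.clarkeNormalCone_epi hf hε
  refine ⟨δ, hδ, fun z hz v hv w hw ↦
    (hc z (hball hz) v hv w hw.1 (hball hw.2)).trans ?_⟩
  have h1 : -v.snd ≤ ‖v‖ := (neg_le_abs _).trans (abs_snd_le v)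
  have h2 : ‖w.fst - z.fst‖ ≤ ‖w - z‖ := norm_fst_le (w - z)
  gcongr

theorem FrechetFirstOrderAt.clarkeFirstOrder {f : E → ℝ} {x₀ : E} (hf : LocallyLipschitz f)
    (h : FrechetFirstOrderAt f x₀) :
    ∀ ε > (0 : ℝ), ∃ δ > (0 : ℝ), ∀ x ∈ closedBall x₀ δ, ∀ y ∈ closedBall x₀ δ,
      ∀ v ∈ clarkeSubdifferential f x, f y - f x ≥ inner ℝ v (y - x) - ε * ‖y - x‖ := by
  intro ε hε
  obtain ⟨δ, hδ, hc⟩ := h.clarkeNormalCone_epi hf hε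
  refine ⟨δ, hδ, fun x hx y hy v hv ↦ ?_⟩
  have h1 := hc (WithLp.toLp 2 (x, f x)) hx _ hv (WithLp.toLp 2 (y, f y)) (le_refl (f y)) hy
  rw [inner_eq_fst_add_snd] at h1
  simp only [WithLp.sub_fst, WithLp.sub_snd, WithLp.toLp_fst, WithLp.toLp_snd] at h1
  linarith

theorem ClarkeSuperRegularAt.frechetFirstOrderAt {f : E → ℝ} {x₀ : E} (hf : LocallyLipschitz f)
    (h : ClarkeSuperRegularAt (epi f) (WithLp.toLp 2 (x₀, f x₀))) : FrechetFirstOrderAt f x₀ := by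
  obtain ⟨L, hL0, R, hR, hL⟩ := hf.exists_closedBall x₀
  intro ε hε
  obtain ⟨δ, hδ, hc⟩ := h.2.2 (ε / (1 + L) ^ 2) (by positivity)
  have hρ : 0 < min (R / 2) (δ / (1 + L)) := lt_min (by positivity) (by positivity)
  refine ⟨min (R / 2) (δ / (1 + L)), hρ, fun x hx y hy v hv ↦ ?_⟩
  have hR2 : ∀ u ∈ closedBall x₀ (min (R / 2) (δ / (1 + L))), u ∈ closedBall x₀ (R / 2) :=
    fun u hu ↦ closedBall_subset_closedBall (min_le_left _ _) hu
  have hR1 : ∀ u ∈ closedBall x₀ (R / 2), u ∈ closedBall x₀ R :=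
    fun u hu ↦ closedBall_subset_closedBall (by linarith) hu
  have hgraph : ∀ u ∈ closedBall x₀ R, ∀ u' ∈ closedBall x₀ R,
      ‖WithLp.toLp 2 (u, f u) - WithLp.toLp 2 (u', f u')‖ ≤ (1 + L) * ‖u - u'‖ := by
    intro u hu u' hu'
    refine (norm_le_fst_add_snd _).trans ?_
    change ‖u - u'‖ + |f u - f u'| ≤ _
    linarith [hL u hu u' hu']
  have hball : ∀ u ∈ closedBall x₀ (min (R / 2) (δ / (1 + L))),
      WithLp.toLp 2 (u, f u) ∈ closedBall (WithLp.toLp 2 (x₀, f x₀)) δ := by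
    intro u hu
    rw [mem_closedBall, dist_eq_norm]
    refine (hgraph u (hR1 u (hR2 u hu)) x₀ (mem_closedBall_self hR.le)).trans ?_
    rw [mul_comm, ← le_div_iff₀ (by positivity), ← dist_eq_norm]
    exact closedBall_subset_closedBall (min_le_right _ _) hu
  have hvL : ‖v‖ ≤ L := by
    refine norm_le_of_mem_frechetSubdifferential hL0 (half_pos hR) (fun u hu ↦ ?_) hv
    refine (le_abs_self _).trans (hL u ?_ x (hR1 x (hR2 x hx)))
    have := hR2 x hx
    rw [mem_closedBall] at *
    linarith [dist_triangle u x x₀]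
  have hvn : ‖WithLp.toLp 2 (v, (-1 : ℝ))‖ ≤ 1 + L := by
    refine (norm_le_fst_add_snd _).trans ?_
    change ‖v‖ + |(-1 : ℝ)| ≤ _
    rw [abs_neg, abs_one]
    linarith
  have h1 := hc _ (hball x hx) _ (limitingNormalCone_subset_clarkeNormalCone _ _
      (frechetNormalCone_subset_limitingNormalCone _ _ (toLp_mem_frechetNormalCone_epi hv)))
    _ ⟨le_refl (f y), hball y hy⟩
  have h2 : ε / (1 + L) ^ 2 * ‖WithLp.toLp 2 (v, (-1 : ℝ))‖ *
      ‖WithLp.toLp 2 (y, f y) - WithLp.toLp 2 (x, f x)‖ ≤ ε * ‖y - x‖ := by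
    calc _ ≤ ε / (1 + L) ^ 2 * (1 + L) * ((1 + L) * ‖y - x‖) := by
          gcongr
          exact hgraph y (hR1 y (hR2 y hy)) x (hR1 x (hR2 x hx))
      _ = ε * ‖y - x‖ := by field_simp
  rw [inner_eq_fst_add_snd] at h1
  simp only [WithLp.sub_fst, WithLp.sub_snd, WithLp.toLp_fst, WithLp.toLp_snd] at h1
  linarith

/-! ### A mean value inequality for Fréchet subgradients -/

/-- A mean value inequality: if `f b - f a < r`, then arbitrarily close to the segment `[a, b]`
there is a Fréchet subgradient `w` with `⟪w, b - a⟫ ≤ r`. Taking `a = b` and `r > 0` shows that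
Fréchet subgradients exist on a dense set. -/
theorem exists_frechetSubdifferential_inner_le [ProperSpace E] {f : E → ℝ} {x₀ : E} {L ρ R : ℝ}
    (hL0 : 0 ≤ L) (hρR : ρ < R)
    (hL : ∀ y ∈ closedBall x₀ R, ∀ z ∈ closedBall x₀ R, |f y - f z| ≤ L * ‖y - z‖)
    {a b : E} (ha : a ∈ closedBall x₀ ρ) (hb : b ∈ closedBall x₀ ρ) {r η : ℝ}
    (hr : f b - f a < r) (hη : 0 < η) :
    ∃ s ∈ Icc (0 : ℝ) 1, ∃ c w : E, ‖c - (a + s • (b - a))‖ ≤ η ∧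
      w ∈ frechetSubdifferential f c ∧ inner ℝ w (b - a) ≤ r := by
  -- The penalty parameter `k` has to beat both the distance to the segment, which is at most
  -- `L / k`, and the gain `L ^ 2 / k` that leaving the segment could bring.
  obtain ⟨k, hk⟩ : ∃ k : ℝ, 0 < k ∧ L ≤ k * η ∧ L < k * (R - ρ) ∧ L ^ 2 < k * (r - (f b - f a)) := by
    have h1 : 0 < R - ρ := sub_pos.2 hρR
    have h2 : 0 < r - (f b - f a) := sub_pos.2 hr
    have e1 := (tendsto_id.atTop_mul_const hη).eventually_ge_atTop L
    have e2 := (tendsto_id.atTop_mul_const h1).eventually_gt_atTop L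
    have e3 := (tendsto_id.atTop_mul_const h2).eventually_gt_atTop (L ^ 2)
    obtain ⟨k, hk⟩ := ((eventually_gt_atTop (0 : ℝ)).and (e1.and (e2.and e3))).exists
    exact ⟨k, hk⟩
  obtain ⟨hk0, hkη, hkR, hkr⟩ := hk
  have hcont : ContinuousOn f (closedBall x₀ R) := by
    refine LipschitzOnWith.continuousOn (K := L.toNNReal) (LipschitzOnWith.of_dist_le_mul ?_)
    intro y hy z hz
    rw [Real.dist_eq, dist_eq_norm, Real.coe_toNNReal _ hL0]
    exact hL y hy z hz
  have haR : a ∈ closedBall x₀ R := closedBall_subset_closedBall hρR.le ha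
  have hbR : b ∈ closedBall x₀ R := closedBall_subset_closedBall hρR.le hb
  have hcomp : IsCompact (Icc (0 : ℝ) 1 ×ˢ closedBall x₀ R) :=
    isCompact_Icc.prod (isCompact_closedBall x₀ R)
  obtain ⟨⟨t, u⟩, ⟨ht, hu⟩, hmin⟩ := hcomp.exists_isMinOn
    (f := fun q : ℝ × E ↦ f q.2 - q.1 * r + k * ‖q.2 - (a + q.1 • (b - a))‖ ^ 2)
    ⟨(0, a), by simp, haR⟩
    (((hcont.comp continuousOn_snd fun q hq ↦ hq.2).sub (by fun_prop)).add (by fun_prop))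
  have hmin' : ∀ t' ∈ Icc (0 : ℝ) 1, ∀ u' ∈ closedBall x₀ R,
      f u - t * r + k * ‖u - (a + t • (b - a))‖ ^ 2 ≤
        f u' - t' * r + k * ‖u' - (a + t' • (b - a))‖ ^ 2 :=
    fun t' ht' u' hu' ↦ hmin (show (t', u') ∈ Icc (0 : ℝ) 1 ×ˢ closedBall x₀ R from ⟨ht', hu'⟩)
  simp only at ht hu
  set p := a + t • (b - a) with hp
  have hpρ : p ∈ closedBall x₀ ρ := (convex_closedBall x₀ ρ).add_smul_sub_mem ha hb ht
  have hpR : p ∈ closedBall x₀ R := closedBall_subset_closedBall hρR.le hpρ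
  have hup : k * ‖u - p‖ ≤ L := by
    have h1 := hmin' t ht p hpR
    rw [← hp, sub_self, norm_zero] at h1
    have h2 := (abs_le.1 (hL u hu p hpR)).1
    rcases (norm_nonneg (u - p)).eq_or_lt with h0 | h0
    · rw [← h0]; simpa using hL0
    · refine le_of_mul_le_mul_right (a := ‖u - p‖) ?_ h0
      nlinarith
  have hudist : dist u x₀ < R := by
    have h1 : ‖u - p‖ < R - ρ := lt_of_mul_lt_mul_left (hup.trans_lt hkR) hk0.le
    rw [← dist_eq_norm] at h1
    linarith [dist_triangle u p x₀, mem_closedBall.1 hpρ]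
  have ht0 : 0 < t := by
    refine lt_of_le_of_ne ht.1 fun h0 ↦ ?_
    have hpa : p = a := by rw [hp, ← h0, zero_smul, add_zero]
    have h1 := hmin' 1 (by simp) b hbR
    rw [one_smul, add_sub_cancel, sub_self, norm_zero, hpa, ← h0] at h1
    have h2 := (abs_le.1 (hL u hu a haR)).1
    rw [hpa] at hup
    have h3 := mul_le_mul_of_nonneg_left hup hL0
    have h4 : k * (r - (f b - f a)) ≤ k * (L * ‖u - a‖) := by
      refine mul_le_mul_of_nonneg_left ?_ hk0.le
      nlinarith [mul_nonneg hk0.le (sq_nonneg ‖u - a‖)]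
    nlinarith
  refine ⟨t, ht, u, -(2 * k) • (u - p), le_of_mul_le_mul_left (hup.trans hkη) hk0, ?_, ?_⟩
  · intro ε hε
    refine ⟨min (R - dist u x₀) (ε / k), lt_min (sub_pos.2 hudist) (by positivity),
      fun y hy ↦ ?_⟩
    have hyR : y ∈ closedBall x₀ R := by
      have := (mem_closedBall.1 hy).trans (min_le_left _ _)
      rw [mem_closedBall]
      linarith [dist_triangle y u x₀]
    have hyε : k * ‖y - u‖ ≤ ε := by
      rw [mul_comm, ← le_div_iff₀ hk0, ← dist_eq_norm]
      exact (mem_closedBall.1 hy).trans (min_le_right _ _)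
    have h1 := hmin' t ht y hyR
    have h2 : ‖y - p‖ ^ 2 = ‖u - p‖ ^ 2 + 2 * inner ℝ (u - p) (y - u) + ‖y - u‖ ^ 2 := by
      rw [← norm_add_sq_real, add_comm (u - p), sub_add_sub_cancel]
    rw [← hp, h2] at h1
    rw [real_inner_smul_left]
    have h3 := mul_le_mul_of_nonneg_right hyε (norm_nonneg (y - u))
    nlinarith
  · rw [real_inner_smul_left]
    have hstep : ∀ h ∈ Ioc (0 : ℝ) t,
        -(2 * k) * inner ℝ (u - p) (b - a) ≤ r + h * (k * ‖b - a‖ ^ 2) := by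
      rintro h ⟨hh0, hht⟩
      have h1 := hmin' (t - h) ⟨by linarith, by linarith [ht.2]⟩ u hu
      have h2 : u - (a + (t - h) • (b - a)) = (u - p) + h • (b - a) := by
        rw [hp, sub_smul]; abel
      rw [h2, norm_add_sq_real, inner_smul_right, norm_smul, Real.norm_eq_abs,
        abs_of_pos hh0] at h1
      refine le_of_mul_le_mul_left ?_ hh0
      nlinarith
    have hlim : Tendsto (fun h : ℝ ↦ r + h * (k * ‖b - a‖ ^ 2)) (𝓝[>] 0) (𝓝 r) := by
      have : Continuous fun h : ℝ ↦ r + h * (k * ‖b - a‖ ^ 2) := by fun_prop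
      simpa using (this.tendsto 0).mono_left nhdsWithin_le_nhds
    refine ge_of_tendsto hlim ?_
    filter_upwards [Ioc_mem_nhdsGT ht0] with h hh using hstep h hh

/-! ### Approximate convexity and submonotonicity -/

theorem ApproximatelyConvexAt.frechetFirstOrderAt {f : E → ℝ} {x₀ : E}
    (h : ApproximatelyConvexAt f x₀) : FrechetFirstOrderAt f x₀ := by
  intro ε hε
  obtain ⟨δ, hδ, hc⟩ := h ε hε
  refine ⟨δ, hδ, fun x hx y hy v hv ↦ ?_⟩
  refine le_of_forall_pos_le_add fun η hη ↦ ?_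
  -- Compare the two bounds for `f (x + t (y - x)) - f x` at a small `t` and divide by `t`.
  obtain ⟨d, hd, hvd⟩ := hv (η / (1 + ‖y - x‖)) (by positivity)
  obtain ⟨t, ht0, ht1, htd⟩ : ∃ t : ℝ, 0 < t ∧ t < 1 ∧ t * ‖y - x‖ ≤ d := by
    refine ⟨min (1 / 2) (d / (1 + ‖y - x‖)), lt_min (by norm_num) (by positivity),
      (min_le_left _ _).trans_lt (by norm_num), ?_⟩
    calc _ ≤ d / (1 + ‖y - x‖) * (1 + ‖y - x‖) := by
          gcongr
          · exact min_le_right _ _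
          · linarith
      _ = d := by field_simp
  have h1 := hc y hy x hx t ⟨ht0, ht1⟩
  have heq : t • y + (1 - t) • x - x = t • (y - x) := by
    rw [sub_smul, one_smul, smul_sub]; abel
  have hn : ‖t • (y - x)‖ = t * ‖y - x‖ := by rw [norm_smul, Real.norm_eq_abs, abs_of_pos ht0]
  have h2 := hvd (t • y + (1 - t) • x) (by rw [mem_closedBall, dist_eq_norm, heq, hn]; exact htd)
  rw [heq, hn, inner_smul_right] at h2
  have h3 : η / (1 + ‖y - x‖) * ‖y - x‖ ≤ η := by
    rw [div_mul_eq_mul_div, div_le_iff₀ (by positivity)]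
    nlinarith [norm_nonneg (y - x)]
  have h4 := mul_le_mul_of_nonneg_left h3 ht0.le
  have h5 : 0 ≤ ε * t * t * ‖y - x‖ := by positivity
  refine le_of_mul_le_mul_left ?_ ht0
  nlinarith

theorem FrechetFirstOrderAt.approximatelyConvexAt [ProperSpace E] {f : E → ℝ} {x₀ : E}
    (hf : LocallyLipschitz f) (h : FrechetFirstOrderAt f x₀) : ApproximatelyConvexAt f x₀ := by
  obtain ⟨L, hL0, R, hR, hL⟩ := hf.exists_closedBall x₀
  intro ε hε
  obtain ⟨δ, hδ, hfo⟩ := h (ε / 2) (by positivity)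
  -- Subgradients are taken near the convex combination, hence the room left around it.
  set ρ := min (δ / 2) (R / 4)
  have hρ0 : 0 < ρ := lt_min (by positivity) (by positivity)
  have hρδ : ρ ≤ δ / 2 := min_le_left _ _
  have hρR : ρ ≤ R / 4 := min_le_right _ _
  refine ⟨ρ, hρ0, fun x hx y hy t ⟨ht0, ht1⟩ ↦ ?_⟩
  set z := t • x + (1 - t) • y with hz
  have hzb : z ∈ closedBall x₀ ρ :=
    convex_closedBall x₀ ρ hx hy ht0.le (by linarith) (by ring)
  refine le_of_forall_pos_le_add fun η hη ↦ ?_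
  obtain ⟨κ, hκ0, hκρ, hκη⟩ : ∃ κ : ℝ, 0 < κ ∧ κ ≤ ρ ∧ (2 * L + ε) * κ ≤ η :=
    ⟨min ρ (η / (2 * L + ε)), lt_min hρ0 (by positivity), min_le_left _ _, by
      rw [mul_comm, ← le_div_iff₀ (by positivity)]; exact min_le_right _ _⟩
  obtain ⟨s, -, c, w, hc, hw, -⟩ := exists_frechetSubdifferential_inner_le (ρ := ρ) (r := 1) hL0
    (by linarith) hL hzb hzb (by simp) hκ0
  rw [sub_self, smul_zero, add_zero] at hc
  have hcb : dist c x₀ ≤ 2 * ρ := by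
    rw [← dist_eq_norm] at hc
    linarith [dist_triangle c z x₀, mem_closedBall.1 hzb]
  have hcR : c ∈ closedBall x₀ R := by rw [mem_closedBall]; linarith
  have hwL : ‖w‖ ≤ L := by
    refine norm_le_of_mem_frechetSubdifferential hL0 (half_pos hR) (fun u hu ↦ ?_) hw
    refine (le_abs_self _).trans (hL u ?_ c hcR)
    rw [mem_closedBall] at *
    linarith [dist_triangle u c x₀]
  have hcδ : c ∈ closedBall x₀ δ := by rw [mem_closedBall]; linarith
  have hx' := hfo c hcδ x (closedBall_subset_closedBall (by linarith) hx) w hw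
  have hy' := hfo c hcδ y (closedBall_subset_closedBall (by linarith) hy) w hw
  have hfz := (abs_le.1 (hL c hcR z (closedBall_subset_closedBall (by linarith) hzb))).1
  have hzc : ‖z - c‖ ≤ κ := by rwa [norm_sub_rev]
  have hin : -(L * κ) ≤ inner ℝ w (z - c) := by
    have h1 := (abs_le.1 (abs_real_inner_le_norm w (z - c))).1
    have h2 : ‖w‖ * ‖z - c‖ ≤ L * κ := by gcongr
    linarith
  have hsum : t * inner ℝ w (x - c) + (1 - t) * inner ℝ w (y - c) = inner ℝ w (z - c) := by
    rw [← inner_smul_right, ← inner_smul_right, ← inner_add_right]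
    congr 1
    rw [hz]; module
  have hxc : ‖x - c‖ ≤ (1 - t) * ‖x - y‖ + κ := by
    have : x - c = (1 - t) • (x - y) + (z - c) := by rw [hz]; module
    rw [this]
    refine (norm_add_le _ _).trans ?_
    rw [norm_smul, Real.norm_eq_abs, abs_of_pos (by linarith)]
    linarith
  have hyc : ‖y - c‖ ≤ t * ‖x - y‖ + κ := by
    have : y - c = -(t • (x - y)) + (z - c) := by rw [hz]; module
    rw [this]
    refine (norm_add_le _ _).trans ?_
    rw [norm_neg, norm_smul, Real.norm_eq_abs, abs_of_pos ht0]
    linarith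
  have hLκ : L * ‖c - z‖ ≤ L * κ := by gcongr
  have h1t : 0 < 1 - t := by linarith
  have a1 := mul_le_mul_of_nonneg_left hx' ht0.le
  have a2 := mul_le_mul_of_nonneg_left hy' h1t.le
  have b1 := mul_le_mul_of_nonneg_left hxc (by positivity : 0 ≤ t * (ε / 2))
  have b2 := mul_le_mul_of_nonneg_left hyc (by positivity : 0 ≤ (1 - t) * (ε / 2))
  have b3 : 0 ≤ ε * κ := by positivity
  linarith

theorem mem_limitingSubdifferential_of_frechet {f : E → ℝ} {x v : E}
    (hv : v ∈ frechetSubdifferential f x) : v ∈ limitingSubdifferential f x :=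
  frechetNormalCone_subset_limitingNormalCone _ _ (toLp_mem_frechetNormalCone_epi hv)

theorem limitingSubdifferential_subset_clarkeSubdifferential (f : E → ℝ) (x : E) :
    limitingSubdifferential f x ⊆ clarkeSubdifferential f x := fun _ hv ↦
  limitingNormalCone_subset_clarkeNormalCone _ _ hv

theorem submonotoneAt_limitingSubdifferential {f : E → ℝ} {x₀ : E}
    (h : ∀ ε > (0 : ℝ), ∃ δ > (0 : ℝ), ∀ x ∈ closedBall x₀ δ, ∀ y ∈ closedBall x₀ δ,
      ∀ v ∈ clarkeSubdifferential f x, f y - f x ≥ inner ℝ v (y - x) - ε * ‖y - x‖) :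
    SubmonotoneAt (limitingSubdifferential f) x₀ := by
  intro ε hε
  obtain ⟨δ, hδ, hc⟩ := h (ε / 2) (by positivity)
  refine ⟨δ, hδ, fun x₁ h₁ x₂ h₂ v₁ hv₁ v₂ hv₂ ↦ ?_⟩
  have a := hc x₁ h₁ x₂ h₂ v₁ (limitingSubdifferential_subset_clarkeSubdifferential f x₁ hv₁)
  have b := hc x₂ h₂ x₁ h₁ v₂ (limitingSubdifferential_subset_clarkeSubdifferential f x₂ hv₂)
  rw [← neg_sub x₁ x₂, inner_neg_right, norm_neg] at a
  rw [inner_sub_left]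
  linarith

/-- Submonotonicity gives the first-order inequality. If it failed at `x`, `y`, `v`, the mean value
inequality would give a subgradient `w` near the segment whose slope along `y - x` is too small
compared with `v`. -/
theorem SubmonotoneAt.frechetFirstOrderAt [ProperSpace E] {f : E → ℝ} {x₀ : E}
    (hf : LocallyLipschitz f) (h : SubmonotoneAt (limitingSubdifferential f) x₀) :
    FrechetFirstOrderAt f x₀ := by
  obtain ⟨L, hL0, R, hR, hL⟩ := hf.exists_closedBall x₀
  intro ε hε
  obtain ⟨δ, hδ, hmono⟩ := h (ε / 2) (by positivity)
  set ρ := min (δ / 2) (R / 4)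
  have hρ0 : 0 < ρ := lt_min (by positivity) (by positivity)
  have hρδ : ρ ≤ δ / 2 := min_le_left _ _
  have hρR : ρ ≤ R / 4 := min_le_right _ _
  refine ⟨ρ, hρ0, fun x hx y hy v hv ↦ ?_⟩
  by_contra! hlt
  have hD : 0 < ‖y - x‖ := by
    rw [norm_pos_iff]
    intro h0
    rw [sub_eq_zero.1 h0] at hlt
    simp at hlt
  -- Since `v` is a subgradient at `x`, the inequality holds at a point `a` of the segment close to
  -- `x`, so it fails on `[a, y]`; this keeps the subgradient `w` found below away from `x`.
  obtain ⟨d, hd, hvd⟩ := hv ε hε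
  obtain ⟨τ, hτ0, hτ1, hτd⟩ : ∃ τ : ℝ, 0 < τ ∧ τ < 1 ∧ τ * ‖y - x‖ ≤ d :=
    ⟨min (1 / 2) (d / ‖y - x‖), lt_min (by norm_num) (by positivity),
      (min_le_left _ _).trans_lt (by norm_num), by
        rw [← le_div_iff₀ hD]; exact min_le_right _ _⟩
  set a := x + τ • (y - x) with ha
  have hax : a - x = τ • (y - x) := add_sub_cancel_left _ _
  have hnax : ‖a - x‖ = τ * ‖y - x‖ := by rw [hax, norm_smul, Real.norm_eq_abs, abs_of_pos hτ0]
  have hfa := hvd a (by rw [mem_closedBall, dist_eq_norm, hnax]; exact hτd)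
  rw [hnax, hax, inner_smul_right] at hfa
  have hab : a ∈ closedBall x₀ ρ :=
    (convex_closedBall x₀ ρ).add_smul_sub_mem hx hy ⟨hτ0.le, hτ1.le⟩
  obtain ⟨κ, hκ0, hκρ, hκ⟩ : ∃ κ : ℝ, 0 < κ ∧ κ ≤ ρ ∧
      (L + ‖v‖ + ε) * κ ≤ τ * (ε / 4 * ‖y - x‖) :=
    ⟨min ρ (τ * (ε / 4 * ‖y - x‖) / (L + ‖v‖ + ε)), lt_min hρ0 (by positivity),
      min_le_left _ _, by rw [mul_comm, ← le_div_iff₀ (by positivity)]; exact min_le_right _ _⟩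
  obtain ⟨s, hs, c, w, hc, hw, hwr⟩ := exists_frechetSubdifferential_inner_le (ρ := ρ)
    (r := (1 - τ) * (inner ℝ v (y - x) - ε * ‖y - x‖)) hL0 (by linarith) hL hab hy
    (by linarith) hκ0
  have h1τ : 0 < 1 - τ := by linarith
  have hya : y - a = (1 - τ) • (y - x) := by rw [ha]; module
  rw [hya, inner_smul_right] at hwr
  have hslope : inner ℝ (w - v) (y - x) ≤ -(ε * ‖y - x‖) := by
    rw [inner_sub_left]
    linarith [le_of_mul_le_mul_left hwr h1τ]
  have hpb : a + s • (y - a) ∈ closedBall x₀ ρ :=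
    (convex_closedBall x₀ ρ).add_smul_sub_mem hab hy hs
  have hcb : dist c x₀ ≤ 2 * ρ := by
    have := hc
    rw [← dist_eq_norm] at this
    linarith [dist_triangle c (a + s • (y - a)) x₀, mem_closedBall.1 hpb]
  have hcR : c ∈ closedBall x₀ R := by rw [mem_closedBall]; linarith
  have hwL : ‖w‖ ≤ L := by
    refine norm_le_of_mem_frechetSubdifferential hL0 (half_pos hR) (fun u hu ↦ ?_) hw
    refine (le_abs_self _).trans (hL u ?_ c hcR)
    rw [mem_closedBall] at *
    linarith [dist_triangle u c x₀]
  have hm := hmono c (by rw [mem_closedBall]; linarith) x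
    (closedBall_subset_closedBall (by linarith) hx) w (mem_limitingSubdifferential_of_frechet hw)
    v (mem_limitingSubdifferential_of_frechet hv)
  set e := c - (a + s • (y - a)) with he
  set σ := τ + s * (1 - τ) with hσ
  have hσ0 : τ ≤ σ := by have := mul_nonneg hs.1 h1τ.le; linarith
  have hcx : c - x = σ • (y - x) + e := by rw [he, hσ, hya, ha]; module
  have hncx : ‖c - x‖ ≤ σ * ‖y - x‖ + κ := by
    rw [hcx]
    refine (norm_add_le _ _).trans ?_
    rw [norm_smul, Real.norm_eq_abs, abs_of_pos (by linarith)]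
    linarith
  have hine : inner ℝ (w - v) e ≤ (L + ‖v‖) * κ := by
    refine (real_inner_le_norm _ _).trans ?_
    have : ‖w - v‖ ≤ L + ‖v‖ := (norm_sub_le _ _).trans (by linarith)
    gcongr
  have hin : inner ℝ (w - v) (c - x) = σ * inner ℝ (w - v) (y - x) + inner ℝ (w - v) e := by
    rw [hcx, inner_add_right, inner_smul_right]
  have h1 := mul_le_mul_of_nonneg_left hslope (hτ0.le.trans hσ0)
  have h2 := mul_le_mul_of_nonneg_left hncx (by positivity : 0 ≤ ε / 2)
  have h3 := mul_le_mul_of_nonneg_right hσ0 (by positivity : 0 ≤ ε / 4 * ‖y - x‖)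
  have h4 : 0 < τ * (ε / 4 * ‖y - x‖) := by positivity
  have h5 : 0 < ε * κ := by positivity
  linarith

end ClarkeReg

theorem mainTheorem2 (n : ℕ) (f : EuclideanSpace ℝ (Fin n) → ℝ) (hf : LocallyLipschitz f)
    (x₀ : EuclideanSpace ℝ (Fin n)) :
    List.TFAE
      [ClarkeReg.ClarkeSuperRegularAt (ClarkeReg.epi f) (WithLp.toLp 2 (x₀, f x₀)),
       ClarkeReg.ApproximatelyConvexAt f x₀,
       ∀ ε > (0 : ℝ), ∃ δ > (0 : ℝ), ∀ x ∈ Metric.closedBall x₀ δ,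
         ∀ y ∈ Metric.closedBall x₀ δ, ∀ v ∈ ClarkeReg.clarkeSubdifferential f x,
           f y - f x ≥ inner ℝ v (y - x) - ε * ‖y - x‖,
       ClarkeReg.SubmonotoneAt (ClarkeReg.limitingSubdifferential f) x₀] := by
  tfae_have 1 → 2 := fun h ↦ (h.frechetFirstOrderAt hf).approximatelyConvexAt hf
  tfae_have 2 → 3 := fun h ↦ h.frechetFirstOrderAt.clarkeFirstOrder hf
  tfae_have 3 → 4 := ClarkeReg.submonotoneAt_limitingSubdifferential
  tfae_have 4 → 1 := fun h ↦ (h.frechetFirstOrderAt hf).clarkeSuperRegularAt hf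
  tfae_finish
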